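/- Let $\epsilon>0$. For $n\ge 1$ put $B=2^{(1/2+\epsilon)n^2}$ and let $B_1,\dots,B_n$ be independent and uniformly distributed on $\{1,\dots,\lfloor B\rfloor\}$. Let $\mathbf e\in\{0,1\}^n$ be fixed and put $B_0=\sum_{i=1}^n B_ie_i$. For a noise vector $\varepsilon\in\{-1,0,1\}^n$ suppose that one is given $B_0$ exactly and the noisy weights $B_i+\varepsilon_i$. Let $M$ be the $(n+2)\times(n+1)$ integer matrix whose first row is $(B_0,-B_1-\varepsilon_1,\dots,-B_n-\varepsilon_n)$ and whose other $n+1$ rows form the identity matrix, and let $\mathbf f=M[1;\mathbf e]$. (i) Always $\mathbf f=[f_0;1;\mathbf e]$ with an integer $f_0$ such that $|f_0|\le n$. (ii) There is an $n_0=n_0(\epsilon)$, depending only on $\epsilon$, such that for all $n>n_0$ and all $\mathbf e\in\{0,1\}^n$ the following holds with probability at least $1-2^{-\epsilon n^2/2}$ over $B_1,\dots,B_n$ (so the failure probability is $O(2^{-\epsilon n^2/2})$): for every noise vector $\varepsilon\in\{-1,0,1\}^n$, the LLL algorithm (with parameter $3/4$), run on the columns of $M$, halts, the first vector $\mathbf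 x=[x_0;x_0';x_1;\dots;x_n]$ of the basis that it returns is a nonzero integer multiple of $\mathbf f$, and hence the subset sum problem is solved: $e_i=x_i/x_0'$ for $i=1,\dots,n$. -/

import Mathlib

open MeasureTheory ProbabilityTheory

noncomputable section

namespace NoisySubsetSum

/-! ### The LLL lattice basis reduction algorithm -/

/-- An integer vector, seen in Euclidean space. -/
def toEuclid {N : ℕ} (v : Fin N → ℤ) : EuclideanSpace ℝ (Fin N) :=
  WithLp.toLp 2 fun i => (v i : ℝ)

/-- The Gram-Schmidt vectors `b₀*, …, b_{d-1}*` (not normalized) of `b₀, …, b_{d-1}`. -/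
def gs {d N : ℕ} (b : Fin d → Fin N → ℤ) : Fin d → EuclideanSpace ℝ (Fin N) :=
  InnerProductSpace.gramSchmidt ℝ fun i => toEuclid (b i)

/-- The Gram-Schmidt coefficient `μ i j = ⟨b_i, b_j*⟩ / ⟨b_j*, b_j*⟩`. -/
def mu {d N : ℕ} (b : Fin d → Fin N → ℤ) (i j : Fin d) : ℝ :=
  inner ℝ (gs b j) (toEuclid (b i)) / ‖gs b j‖ ^ 2

/-- If `|μ k l| > 1/2`, replace `b_k` by `b_k - r b_l`, with `r` the integer nearest to `μ k l`. -/
def reduceAt {d N : ℕ} (b : Fin d → Fin N → ℤ) (k l : Fin d) : Fin d → Fin N → ℤ :=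
  if 1 / 2 < |mu b k l| then Function.update b k (b k - round (mu b k l) • b l) else b

/-- Apply `reduceAt · k j` successively for `j = l - 1, l - 2, …, 0`. -/
def reduceBelow {d N : ℕ} (k : Fin d) :
    (l : ℕ) → l ≤ (k : ℕ) → (Fin d → Fin N → ℤ) → (Fin d → Fin N → ℤ)
  | 0, _, b => b
  | l + 1, h, b =>
      reduceBelow k l (Nat.le_of_succ_le h)
        (reduceAt b k ⟨l, lt_of_lt_of_le (Nat.lt_of_succ_le h) k.isLt.le⟩)

/-- One iteration of the main loop of LLL, with the parameter `3/4`. A state is the current basis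
`b` and the current index `k`, numbered from `0`; states with `k ≥ d` are final. -/
def lllStep {d N : ℕ} : (Fin d → Fin N → ℤ) × ℕ → (Fin d → Fin N → ℤ) × ℕ
  | (b, 0) => (b, 1)
  | (b, k + 1) =>
      if h : k + 1 < d then
        let k₀ : Fin d := ⟨k, Nat.lt_of_succ_lt h⟩
        let k₁ : Fin d := ⟨k + 1, h⟩
        let b' := reduceAt b k₁ k₀
        if ‖gs b' k₁‖ ^ 2 < (3 / 4 - mu b' k₁ k₀ ^ 2) * ‖gs b' k₀‖ ^ 2 then
          (b' ∘ Equiv.swap k₀ k₁, max k 1)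
        else
          (reduceBelow k₁ k (Nat.le_succ k) b', k + 2)
      else (b, k + 1)

/-- LLL, started on the basis given by the columns of `M`, halts, and the first vector of the
basis that it outputs is `x`. -/
def LLLReturns {N d : ℕ} (M : Matrix (Fin N) (Fin (d + 1)) ℤ) (x : Fin N → ℤ) : Prop :=
  ∃ t : ℕ, d + 1 ≤ (lllStep^[t] (M.transpose, 1)).2 ∧ x = (lllStep^[t] (M.transpose, 1)).1 0

/-! ### The subset sum instance -/

/-- The exact target `B₀ = ∑ B_i e_i`. -/
def target {n : ℕ} (B e : Fin n → ℤ) : ℤ := ∑ i, B i * e i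

/-- The `(n+2) × (n+1)` matrix with first row `B₀, -w₁, …, -w_n` and, below it, the identity
matrix of size `n+1`. -/
def latticeMatrix {n : ℕ} (B₀ : ℤ) (w : Fin n → ℤ) : Matrix (Fin (n + 2)) (Fin (n + 1)) ℤ :=
  Matrix.of (Fin.cons (Fin.cons B₀ fun i => -w i) fun i j => if i = j then 1 else 0)

/-- The matrix built from the given data `B₀, B₁ + ν₁, …, B_n + ν_n`. -/
def noisyMatrix {n : ℕ} (B e ν : Fin n → ℤ) : Matrix (Fin (n + 2)) (Fin (n + 1)) ℤ :=
  latticeMatrix (target B e) (B + ν)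

/-- The lattice vector `f = M [1; e]`. -/
def fVec {n : ℕ} (B e ν : Fin n → ℤ) : Fin (n + 2) → ℤ :=
  (noisyMatrix B e ν).mulVec (Fin.cons 1 e)

/-- `ν ∈ {-1, 0, 1}^n`. -/
def IsNoise {n : ℕ} (ν : Fin n → ℤ) : Prop := ∀ i, ν i = -1 ∨ ν i = 0 ∨ ν i = 1

/-- The candidate solution read off from `x = [x₀; x₀'; x₁; …; x_n]`: the quotients
`x_i / x₀'`. -/
def decode {n : ℕ} (x : Fin (n + 2) → ℤ) : Fin n → ℤ := fun i => x i.succ.succ / x 1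

/-- On the noisy data, LLL returns a nonzero integer multiple of `f`, and the solution read off
from the returned vector is `e`. -/
def Solved {n : ℕ} (B e ν : Fin n → ℤ) : Prop :=
  ∃ x : Fin (n + 2) → ℤ, LLLReturns (noisyMatrix B e ν) x ∧
    (∃ k : ℤ, k ≠ 0 ∧ x = k • fVec B e ν) ∧ decode x = e

/-- The largest weight, `⌊2 ^ ((1/2 + ε) n²)⌋`. -/
def maxWeight (ε : ℝ) (n : ℕ) : ℤ := ⌊(2 : ℝ) ^ ((1 / 2 + ε) * (n : ℝ) ^ 2)⌋

/-- The law of `n` independent weights, each uniform on `{1, …, maxWeight ε n}`. -/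
def weightLaw (ε : ℝ) (n : ℕ) : Measure (Fin n → ℤ) :=
  Measure.pi fun _ => uniformOn (Set.Icc 1 (maxWeight ε n))

end NoisySubsetSum

end

/-!
LLL returns a nonzero lattice vector `x` at most `2 ^ (n / 2)` times as long as any other one, in
particular as `f`, whose squared length is at most `n² + n + 1`. The proof of this
(`exists_lllReturns`) rests on two facts. Size reduction leaves the Gram-Schmidt vectors alone, so
that the loop invariant `LLLInv` only has to record the lattice, the independence of the basis and
the inequality `‖b_i*‖² ≤ 2 ‖b_{i+1}*‖²` below the current index. And an exchange lowers exactly one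
of the Gram determinants `∏_{j ≤ i} ‖b_j*‖²`, which are positive integers, and keeps the others;
therefore the loop halts (`LLLInv.exists_halt`).

Write `x = M c`. Then `∑ B_i (c_0 e_i - c_i) = m` with `m = x_0 + ∑ ν_i c_i`, and both `c` and `m`
are small. If all the coefficients `c_0 e_i - c_i` vanish, then `x = c_0 f`, and the instance is
solved (`solved_of_forall_sum_ne`). For a fixed choice of `c` and `m` such that some coefficient
does not vanish, the relation has probability at most `1 / ⌊B⌋` (`pi_setOf_sum_mul_eq_le`), since it
determines the weight at that place from the other ones. The noise enters only through `m`, so that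
a union bound over the `2 ^ (n² / 2 + O(n log n))` pairs `(c, m)` covers all noise vectors at once
(`weightLaw_not_solved_le`), and its quotient by `⌊B⌋` is at most `2 ^ (-ε n² / 2)` for large `n`
(`eventually_unionBound_le`).
-/

noncomputable section

namespace NoisySubsetSum

/-! ### Gram-Schmidt orthogonalization under the operations of LLL -/

section GramSchmidt

open InnerProductSpace Finset

variable {ι E : Type*} [LinearOrder ι] [LocallyFiniteOrderBot ι] [WellFoundedLT ι]
  [NormedAddCommGroup E] [InnerProductSpace ℝ E]

theorem gramSchmidt_congr {f g : ι → E} (i : ι) (h : ∀ j ≤ i, f j = g j) :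
    gramSchmidt ℝ f i = gramSchmidt ℝ g i := by
  induction i using WellFoundedLT.induction with
  | ind i ih =>
    rw [gramSchmidt_def, gramSchmidt_def, h i le_rfl]
    congr 1
    refine sum_congr rfl fun j hj => ?_
    have hj' := mem_Iio.1 hj
    rw [ih j hj' fun l hl => h l (hl.trans hj'.le)]

theorem inner_gramSchmidt_self (f : ι → E) (i : ι) :
    inner ℝ (gramSchmidt ℝ f i) (f i) = ‖gramSchmidt ℝ f i‖ ^ 2 := by
  conv_lhs => rw [gramSchmidt_def'' ℝ f i]
  rw [inner_add_right, inner_sum, sum_eq_zero, add_zero, real_inner_self_eq_norm_sq]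
  intro j hj
  rw [inner_smul_right, gramSchmidt_orthogonal ℝ f (mem_Iio.1 hj).ne', mul_zero]

/-- Projecting away the Gram-Schmidt vectors below `k` kills every `f l` with `l < k`. -/
theorem sum_starProjection_gramSchmidt (f : ι → E) {l k : ι} (h : l < k) :
    ∑ i ∈ Iio k, (ℝ ∙ gramSchmidt ℝ f i).starProjection (f l) = f l := by
  have hsub : insert l (Iio l) ⊆ Iio k := by
    intro i hi
    rcases mem_insert.1 hi with rfl | hi
    · exact mem_Iio.2 h
    · exact mem_Iio.2 ((mem_Iio.1 hi).trans h)
  rw [← sum_subset hsub, sum_insert (by simp)]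
  · conv_rhs => rw [gramSchmidt_def' ℝ f l]
    congr 1
    rw [Submodule.starProjection_singleton, inner_gramSchmidt_self]
    by_cases h0 : gramSchmidt ℝ f l = 0
    · simp [h0]
    · have : ‖gramSchmidt ℝ f l‖ ≠ 0 := norm_ne_zero_iff.2 h0
      simp [this]
  · intro i _ hi
    have hli : l < i := by
      rw [mem_insert, mem_Iio, not_or, not_lt] at hi
      exact lt_of_le_of_ne hi.2 (Ne.symm hi.1)
    rw [Submodule.starProjection_singleton, gramSchmidt_inv_triangular ℝ f hli, zero_div, zero_smul]

/-- Size reduction does not change the Gram-Schmidt vectors. -/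
theorem gramSchmidt_update_sub_smul (f : ι → E) {l k : ι} (h : l < k) (r : ℝ) :
    gramSchmidt ℝ (Function.update f k (f k - r • f l)) = gramSchmidt ℝ f := by
  funext i
  induction i using WellFoundedLT.induction with
  | ind i ih =>
    have hs : ∀ v : E, ∑ j ∈ Iio i,
        (ℝ ∙ gramSchmidt ℝ (Function.update f k (f k - r • f l)) j).starProjection v =
        ∑ j ∈ Iio i, (ℝ ∙ gramSchmidt ℝ f j).starProjection v := fun v =>
      sum_congr rfl fun j hj => by rw [ih j (mem_Iio.1 hj)]
    rw [gramSchmidt_def, gramSchmidt_def ℝ f, hs]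
    by_cases hik : i = k
    · subst hik
      simp only [Function.update_self, map_sub, map_smul, sum_sub_distrib, ← smul_sum]
      rw [sum_starProjection_gramSchmidt f h]
      abel
    · rw [Function.update_of_ne hik]

theorem gramSchmidt_swap_of_lt (f : ι → E) {i k k' : ι} (hk : k < k') (h : i < k) :
    gramSchmidt ℝ (f ∘ Equiv.swap k k') i = gramSchmidt ℝ f i :=
  gramSchmidt_congr i fun j hj => by
    rw [Function.comp_apply, Equiv.swap_apply_of_ne_of_ne (hj.trans_lt h).ne
      ((hj.trans_lt h).trans hk).ne]

/-- The effect of exchanging two consecutive vectors on the first of the two affected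
Gram-Schmidt vectors. -/
theorem gramSchmidt_swap (f : ι → E) {k k' : ι} (h : k ⋖ k') :
    gramSchmidt ℝ (f ∘ Equiv.swap k k') k = gramSchmidt ℝ f k' +
      (inner ℝ (gramSchmidt ℝ f k) (f k') / ‖gramSchmidt ℝ f k‖ ^ 2) • gramSchmidt ℝ f k := by
  have hI : Iio k' = insert k (Iio k) := by
    ext j
    simp only [mem_Iio, mem_insert]
    rw [← le_iff_eq_or_lt]
    exact ⟨fun hj => h.le_of_lt hj, fun hj => hj.trans_lt h.lt⟩
  rw [gramSchmidt_def, gramSchmidt_def ℝ f k', hI, sum_insert (by simp),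
    Submodule.starProjection_singleton (𝕜 := ℝ) (v := gramSchmidt ℝ f k) (f k')]
  rw [sum_congr rfl fun j hj => by rw [gramSchmidt_swap_of_lt f h.lt (mem_Iio.1 hj)]]
  simp only [Function.comp_apply, Equiv.swap_apply_left, RCLike.ofReal_real_eq_id, id]
  abel

theorem norm_gramSchmidt_swap_sq (f : ι → E) {k k' : ι} (h : k ⋖ k') :
    ‖gramSchmidt ℝ (f ∘ Equiv.swap k k') k‖ ^ 2 = ‖gramSchmidt ℝ f k'‖ ^ 2 +
      (inner ℝ (gramSchmidt ℝ f k) (f k') / ‖gramSchmidt ℝ f k‖ ^ 2) ^ 2 *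
        ‖gramSchmidt ℝ f k‖ ^ 2 := by
  rw [gramSchmidt_swap f h, norm_add_sq_real, inner_smul_right,
    gramSchmidt_orthogonal ℝ f h.lt.ne', norm_smul, mul_pow, Real.norm_eq_abs, sq_abs]
  ring

/-- The determinant of the Gram matrix of an initial segment of a family is the product of the
squared lengths of its Gram-Schmidt vectors. -/
theorem det_gram_Iic [Fintype ι] (f : ι → E) (i : ι) :
    (Matrix.gram ℝ fun p : {j // j ≤ i} => f p).det =
      ∏ j : {j // j ≤ i}, ‖gramSchmidt ℝ f j‖ ^ 2 := by
  -- `f p = ∑ r, c p r • gramSchmidt f r` with `c` unitriangular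
  let c : ι → ι → ℝ := fun p r => if r = p then 1 else if r < p then
    inner ℝ (gramSchmidt ℝ f r) (f p) / ‖gramSchmidt ℝ f r‖ ^ 2 else 0
  have hc0 : ∀ p r, p < r → c p r = 0 := fun p r h => by simp [c, h.ne', h.not_gt]
  have hf : ∀ p, f p = ∑ r, c p r • gramSchmidt ℝ f r := by
    intro p
    have hsub : insert p (Iio p) ⊆ univ := subset_univ _
    rw [← sum_subset hsub, sum_insert (by simp)]
    · conv_lhs => rw [gramSchmidt_def'' ℝ f p]
      congr 1
      · simp [c]
      · refine sum_congr rfl fun j hj => ?_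
        have hj' := mem_Iio.1 hj
        simp [c, hj', hj'.ne]
    · intro r _ hr
      rw [mem_insert, mem_Iio, not_or, not_lt] at hr
      rw [hc0 p r (lt_of_le_of_ne hr.2 (Ne.symm hr.1)), zero_smul]
  let C : Matrix {j // j ≤ i} {j // j ≤ i} ℝ := Matrix.of fun p r => c p r
  have hG : Matrix.gram ℝ (fun p : {j // j ≤ i} => f p) =
      C * Matrix.diagonal (fun j : {j // j ≤ i} => ‖gramSchmidt ℝ f j‖ ^ 2) * C.transpose := by
    ext p q
    rw [Matrix.mul_apply]
    simp only [Matrix.mul_diagonal, Matrix.transpose_apply, Matrix.of_apply, Matrix.gram_apply, C]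
    have h1 : inner ℝ (f p) (f q) = ∑ r, c p r * ‖gramSchmidt ℝ f r‖ ^ 2 * c q r := by
      rw [hf p, hf q, sum_inner]
      refine sum_congr rfl fun r _ => ?_
      rw [inner_sum, sum_eq_single r]
      · rw [inner_smul_left, inner_smul_right, real_inner_self_eq_norm_sq]
        simp only [conj_trivial]
        ring
      · intro s _ hs
        rw [inner_smul_left, inner_smul_right, gramSchmidt_orthogonal ℝ f hs.symm]
        simp
      · simp
    rw [h1, ← sum_subset (filter_subset (· ≤ i) univ),
      sum_subtype _ (p := (· ≤ i)) (fun x => by simp)]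
    intro r _ hr
    have hir : i < r := by simpa using hr
    rw [hc0 p r (p.2.trans_lt hir), zero_mul, zero_mul]
  have hC : C.det = 1 := by
    rw [Matrix.det_of_isLowerTriangular]
    · simp [C, c]
    · intro p q h
      exact hc0 _ _ h
  rw [hG, Matrix.det_mul, Matrix.det_mul, Matrix.det_transpose, hC, Matrix.det_diagonal]
  ring

end GramSchmidt

/-! ### Termination and output of LLL -/

section LLL

open InnerProductSpace

variable {d N : ℕ}

theorem toEuclid_sub_smul (v w : Fin N → ℤ) (r : ℤ) :
    toEuclid (v - r • w) = toEuclid v - (r : ℝ) • toEuclid w := by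
  ext i
  simp [toEuclid]

theorem inner_toEuclid (v w : Fin N → ℤ) :
    inner ℝ (toEuclid v) (toEuclid w) = ((v ⬝ᵥ w : ℤ) : ℝ) := by
  simp only [toEuclid, PiLp.inner_apply, dotProduct, Int.cast_sum, Int.cast_mul]
  exact Finset.sum_congr rfl fun i _ => by simp [mul_comm]

theorem norm_toEuclid_sq (v : Fin N → ℤ) : ‖toEuclid v‖ ^ 2 = ((∑ i, v i ^ 2 : ℤ) : ℝ) := by
  rw [← real_inner_self_eq_norm_sq, inner_toEuclid]
  simp [dotProduct, sq]

theorem gs_update (b : Fin d → Fin N → ℤ) {k l : Fin d} (h : l < k) (r : ℤ) :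
    gs (Function.update b k (b k - r • b l)) = gs b := by
  have : (fun i => toEuclid (Function.update b k (b k - r • b l) i)) =
      Function.update (fun i => toEuclid (b i)) k
        (toEuclid (b k) - (r : ℝ) • toEuclid (b l)) := by
    funext i
    by_cases hi : i = k
    · subst hi
      rw [Function.update_self, Function.update_self, toEuclid_sub_smul]
    · simp [hi]
  rw [gs, this, gramSchmidt_update_sub_smul _ h]
  rfl

theorem span_update (b : Fin d → Fin N → ℤ) {k l : Fin d} (h : l < k) (r : ℤ) :
    Submodule.span ℤ (Set.range (Function.update b k (b k - r • b l))) =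
      Submodule.span ℤ (Set.range b) := by
  set c := Function.update b k (b k - r • b l) with hc
  have hck : c k = b k - r • b l := by simp [hc]
  have hco : ∀ i, i ≠ k → c i = b i := fun i hi => by simp [hc, hi]
  apply le_antisymm <;> rw [Submodule.span_le] <;> rintro _ ⟨i, rfl⟩ <;> by_cases hi : i = k
  · subst hi
    rw [hck]
    exact sub_mem (Submodule.subset_span ⟨i, rfl⟩)
      (Submodule.smul_mem _ _ (Submodule.subset_span ⟨l, rfl⟩))
  · rw [hco i hi]
    exact Submodule.subset_span ⟨i, rfl⟩
  · subst hi
    have : b i = c i + r • c l := by rw [hck, hco l h.ne]; abel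
    rw [this]
    exact add_mem (Submodule.subset_span ⟨i, rfl⟩)
      (Submodule.smul_mem _ _ (Submodule.subset_span ⟨l, rfl⟩))
  · rw [← hco i hi]
    exact Submodule.subset_span ⟨i, rfl⟩

theorem gs_reduceAt (b : Fin d → Fin N → ℤ) {k l : Fin d} (h : l < k) :
    gs (reduceAt b k l) = gs b := by
  unfold reduceAt
  split_ifs
  · exact gs_update b h _
  · rfl

theorem span_reduceAt (b : Fin d → Fin N → ℤ) {k l : Fin d} (h : l < k) :
    Submodule.span ℤ (Set.range (reduceAt b k l)) = Submodule.span ℤ (Set.range b) := by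
  unfold reduceAt
  split_ifs
  · exact span_update b h _
  · rfl

theorem abs_mu_reduceAt_le (b : Fin d → Fin N → ℤ) {k l : Fin d} (h : l < k)
    (h0 : gs b l ≠ 0) : |mu (reduceAt b k l) k l| ≤ 1 / 2 := by
  by_cases hmu : 1 / 2 < |mu b k l|
  · have hr : reduceAt b k l = Function.update b k (b k - round (mu b k l) • b l) := if_pos hmu
    have hn : ‖gs b l‖ ^ 2 ≠ 0 := pow_ne_zero _ (norm_ne_zero_iff.2 h0)
    have hself : inner ℝ (gs b l) (toEuclid (b l)) = ‖gs b l‖ ^ 2 :=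
      inner_gramSchmidt_self (fun i => toEuclid (b i)) l
    have : mu (reduceAt b k l) k l = mu b k l - round (mu b k l) := by
      rw [mu, gs_reduceAt b h, hr, Function.update_self, toEuclid_sub_smul, inner_sub_right,
        inner_smul_right, hself, sub_div, mul_div_assoc, div_self hn, mul_one]
      rfl
    rw [this]
    exact abs_sub_round _
  · rw [show reduceAt b k l = b from if_neg hmu]
    exact not_lt.1 hmu

theorem gs_reduceBelow (k : Fin d) (l : ℕ) (h : l ≤ k) (b : Fin d → Fin N → ℤ) :
    gs (reduceBelow k l h b) = gs b := by
  induction l generalizing b with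
  | zero => rfl
  | succ l ih => rw [reduceBelow, ih, gs_reduceAt _ (Fin.lt_def.2 (Nat.lt_of_succ_le h))]

theorem span_reduceBelow (k : Fin d) (l : ℕ) (h : l ≤ k) (b : Fin d → Fin N → ℤ) :
    Submodule.span ℤ (Set.range (reduceBelow k l h b)) = Submodule.span ℤ (Set.range b) := by
  induction l generalizing b with
  | zero => rfl
  | succ l ih => rw [reduceBelow, ih, span_reduceAt _ (Fin.lt_def.2 (Nat.lt_of_succ_le h))]

/-- The Gram determinant of `b₀, …, b_i`. -/
def gramDet (b : Fin d → Fin N → ℤ) (i : Fin d) : ℤ :=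
  (Matrix.of fun p q : {j // j ≤ i} => b p ⬝ᵥ b q).det

theorem cast_gramDet (b : Fin d → Fin N → ℤ) (i : Fin d) :
    (gramDet b i : ℝ) = ∏ j ∈ Finset.Iic i, ‖gs b j‖ ^ 2 := by
  have h := det_gram_Iic (fun i => toEuclid (b i)) i
  rw [← Finset.prod_subtype (Finset.Iic i) (p := (· ≤ i)) (fun x => by simp)
    (fun j => ‖gramSchmidt ℝ (fun i => toEuclid (b i)) j‖ ^ 2)] at h
  rw [gramDet, Int.cast_det]
  refine Eq.trans (congrArg Matrix.det ?_) h
  ext p q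
  simp [Matrix.gram_apply, inner_toEuclid]

theorem gramDet_pos {b : Fin d → Fin N → ℤ} (h : ∀ i, gs b i ≠ 0) (i : Fin d) :
    0 < gramDet b i := by
  have : (0 : ℝ) < gramDet b i := by
    rw [cast_gramDet]
    exact Finset.prod_pos fun j _ => pow_pos (norm_pos_iff.2 (h j)) 2
  exact_mod_cast this

theorem gramDet_congr {b c : Fin d → Fin N → ℤ} (i : Fin d) (h : ∀ j ≤ i, gs b j = gs c j) :
    gramDet b i = gramDet c i := by
  have : (gramDet b i : ℝ) = gramDet c i := by
    rw [cast_gramDet, cast_gramDet]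
    exact Finset.prod_congr rfl fun j hj => by rw [h j (Finset.mem_Iic.1 hj)]
  exact_mod_cast this

theorem gs_swap_of_lt (b : Fin d → Fin N → ℤ) {i k k' : Fin d} (hk : k < k') (h : i < k) :
    gs (b ∘ Equiv.swap k k') i = gs b i :=
  gramSchmidt_swap_of_lt (fun i => toEuclid (b i)) hk h

/-- Exchanging two consecutive vectors changes only one of the Gram determinants: every other
initial segment of the family contains both vectors or neither. -/
theorem gramDet_swap_of_ne (b : Fin d → Fin N → ℤ) {i k k' : Fin d} (h : k ⋖ k') (hi : i ≠ k) :
    gramDet (b ∘ Equiv.swap k k') i = gramDet b i := by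
  rcases lt_or_gt_of_ne hi with hik | hik
  · exact gramDet_congr i fun j hj => gs_swap_of_lt b h.lt (hj.trans_lt hik)
  · have hk' : k' ≤ i := h.ge_of_gt hik
    have hp : ∀ x, Equiv.swap k k' x ≤ i ↔ x ≤ i := by
      intro x
      by_cases h1 : x = k
      · subst h1; simp [hk', hik.le]
      by_cases h2 : x = k'
      · subst h2; simp [hk', hik.le]
      rw [Equiv.swap_apply_of_ne_of_ne h1 h2]
    rw [gramDet, gramDet, ← Matrix.det_submatrix_equiv_self ((Equiv.swap k k').subtypePerm hp)
      (Matrix.of fun p q : {j // j ≤ i} => b p ⬝ᵥ b q)]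
    rfl

/-- The Gram determinant of an initial segment containing both exchanged vectors is unchanged, and
the Gram-Schmidt vectors in it are nonzero as long as the determinant is. -/
theorem gs_swap_ne_zero {b : Fin d → Fin N → ℤ} (h0 : ∀ i, gs b i ≠ 0) {k k' : Fin d}
    (h : k ⋖ k') (i : Fin d) : gs (b ∘ Equiv.swap k k') i ≠ 0 := by
  have hm : max i k' ≠ k := (h.lt.trans_le (le_max_right _ _)).ne'
  have h1 : (gramDet (b ∘ Equiv.swap k k') (max i k') : ℝ) ≠ 0 := by
    rw [gramDet_swap_of_ne b h hm]
    exact_mod_cast (gramDet_pos h0 _).ne'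
  rw [cast_gramDet, Finset.prod_ne_zero_iff] at h1
  have := h1 i (Finset.mem_Iic.2 (le_max_left _ _))
  exact fun hz => this (by simp [hz])

/-- An exchange because of a failing Lovász condition shortens the `k`-th Gram-Schmidt vector and
leaves the earlier ones in place. -/
theorem gramDet_swap_lt {b : Fin d → Fin N → ℤ} (h0 : ∀ i, gs b i ≠ 0) {k k' : Fin d}
    (h : k ⋖ k') (hlt : ‖gs b k'‖ ^ 2 < (3 / 4 - mu b k' k ^ 2) * ‖gs b k‖ ^ 2) :
    gramDet (b ∘ Equiv.swap k k') k < gramDet b k := by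
  have hk : ‖gs (b ∘ Equiv.swap k k') k‖ ^ 2 < ‖gs b k‖ ^ 2 := by
    have h1 : ‖gs (b ∘ Equiv.swap k k') k‖ ^ 2 =
        ‖gs b k'‖ ^ 2 + mu b k' k ^ 2 * ‖gs b k‖ ^ 2 :=
      norm_gramSchmidt_swap_sq (fun i => toEuclid (b i)) h
    have h2 : 0 < ‖gs b k‖ ^ 2 := pow_pos (norm_pos_iff.2 (h0 k)) 2
    rw [h1]
    linarith
  have : (gramDet (b ∘ Equiv.swap k k') k : ℝ) < gramDet b k := by
    rw [cast_gramDet, cast_gramDet]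
    refine Finset.prod_lt_prod (fun j _ => pow_pos (norm_pos_iff.2 (gs_swap_ne_zero h0 h j)) 2)
      (fun j hj => ?_) ⟨k, Finset.mem_Iic.2 le_rfl, hk⟩
    rcases (Finset.mem_Iic.1 hj).eq_or_lt with rfl | hj
    · exact hk.le
    · rw [gs_swap_of_lt b h.lt hj]
  exact_mod_cast this

/-- The potential of a basis: the product of the Gram determinants of its initial segments. -/
def potential (b : Fin d → Fin N → ℤ) : ℕ := ∏ i, (gramDet b i).natAbs

theorem potential_congr {b c : Fin d → Fin N → ℤ} (h : gs b = gs c) :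
    potential b = potential c :=
  Finset.prod_congr rfl fun i _ => by rw [gramDet_congr i fun j _ => congrFun h j]

theorem potential_swap_lt {b : Fin d → Fin N → ℤ} (h0 : ∀ i, gs b i ≠ 0) {k k' : Fin d}
    (h : k ⋖ k') (hlt : ‖gs b k'‖ ^ 2 < (3 / 4 - mu b k' k ^ 2) * ‖gs b k‖ ^ 2) :
    potential (b ∘ Equiv.swap k k') < potential b := by
  have hk := gramDet_swap_lt h0 h hlt
  have hpos := gramDet_pos (gs_swap_ne_zero h0 h)
  refine Finset.prod_lt_prod (fun i _ => ?_) (fun i _ => ?_) ⟨k, Finset.mem_univ _, ?_⟩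
  · exact Int.natAbs_pos.2 (hpos i).ne'
  · by_cases hi : i = k
    · subst hi
      have := hpos i
      omega
    · rw [gramDet_swap_of_ne b h hi]
  · have := hpos k
    omega

/-- The invariant of the main loop of LLL: the current basis generates the lattice `L`, its
vectors are linearly independent (expressed through the Gram-Schmidt vectors), and below the
current index the Gram-Schmidt vectors decay at most by the factor `2` in squared length. -/
structure LLLInv (L : Submodule ℤ (Fin N → ℤ)) (s : (Fin d → Fin N → ℤ) × ℕ) : Prop where
  span_eq : Submodule.span ℤ (Set.range s.1) = L
  gs_ne_zero : ∀ i, gs s.1 i ≠ 0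
  decay : ∀ i j : Fin d, (i : ℕ) + 1 = j → (j : ℕ) < s.2 → ‖gs s.1 i‖ ^ 2 ≤ 2 * ‖gs s.1 j‖ ^ 2
  one_le : 1 ≤ s.2

/-- An iteration of the main loop either lowers the potential, or keeps it and advances the
index. -/
theorem LLLInv.step {L : Submodule ℤ (Fin N → ℤ)} {s : (Fin d → Fin N → ℤ) × ℕ}
    (hs : LLLInv L s) (hd : s.2 < d) :
    LLLInv L (lllStep s) ∧ (potential (lllStep s).1 < potential s.1 ∨
      potential (lllStep s).1 = potential s.1 ∧ (lllStep s).2 = s.2 + 1) := by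
  obtain ⟨b, k⟩ := s
  obtain _ | k := k
  · exact absurd hs.one_le (by simp)
  obtain ⟨hspan, hne, hdec, -⟩ := hs
  dsimp only at hspan hne hdec hd
  let k₀ : Fin d := ⟨k, Nat.lt_of_succ_lt hd⟩
  let k₁ : Fin d := ⟨k + 1, hd⟩
  have hlt : k₀ < k₁ := Fin.lt_def.2 (Nat.lt_succ_self k)
  have hcov : k₀ ⋖ k₁ := by
    refine ⟨hlt, fun c h1 h2 => ?_⟩
    have h1' : k < (c : ℕ) := h1
    have h2' : (c : ℕ) < k + 1 := h2
    omega
  set b' := reduceAt b k₁ k₀ with hb'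
  have hgs : gs b' = gs b := gs_reduceAt b hlt
  have hne' : ∀ i, gs b' i ≠ 0 := by rwa [hgs]
  have hspan' : Submodule.span ℤ (Set.range b') = L := by rw [hb', span_reduceAt b hlt, hspan]
  by_cases hc : ‖gs b' k₁‖ ^ 2 < (3 / 4 - mu b' k₁ k₀ ^ 2) * ‖gs b' k₀‖ ^ 2
  · have hstep : lllStep (b, k + 1) = (b' ∘ Equiv.swap k₀ k₁, max k 1) := by
      simp only [lllStep]
      rw [dif_pos hd, if_pos hc]
    rw [hstep]
    refine ⟨⟨?_, gs_swap_ne_zero hne' hcov, fun i j hij hj => ?_, le_max_right _ _⟩, Or.inl ?_⟩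
    · dsimp only
      rw [(Equiv.swap k₀ k₁).surjective.range_comp, hspan']
    · have hj' : j < k₀ := by
        rw [Fin.lt_def]
        change (j : ℕ) < k
        dsimp only at hj
        omega
      have hi' : i < k₀ := by
        rw [Fin.lt_def] at hj' ⊢
        omega
      dsimp only
      rw [gs_swap_of_lt b' hlt hj', gs_swap_of_lt b' hlt hi', hgs]
      exact hdec i j hij (Nat.lt_succ_of_lt hj')
    · rw [← potential_congr hgs]
      exact potential_swap_lt hne' hcov hc
  · have hstep : lllStep (b, k + 1) = (reduceBelow k₁ k (Nat.le_succ k) b', k + 2) := by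
      simp only [lllStep]
      rw [dif_pos hd, if_neg hc]
    have hgs' : gs (reduceBelow k₁ k (Nat.le_succ k) b') = gs b := by rw [gs_reduceBelow, hgs]
    rw [hstep]
    refine ⟨⟨?_, ?_, fun i j hij hj => ?_, by simp⟩, Or.inr ⟨potential_congr hgs', rfl⟩⟩
    · dsimp only
      rw [span_reduceBelow, hspan']
    · dsimp only
      rwa [hgs']
    · dsimp only at hj ⊢
      rw [hgs']
      rcases Nat.lt_succ_iff_lt_or_eq.1 hj with hj | hj
      · exact hdec i j hij hj
      · obtain rfl : j = k₁ := Fin.ext hj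
        obtain rfl : i = k₀ := Fin.ext (Nat.succ_injective (hij.trans hj))
        have hmu : mu b' k₁ k₀ ^ 2 ≤ (1 / 2) ^ 2 :=
          sq_le_sq' (abs_le.1 (abs_mu_reduceAt_le b hlt (hne k₀))).1
            (abs_le.1 (abs_mu_reduceAt_le b hlt (hne k₀))).2
        rw [not_lt, hgs] at hc
        have := mul_le_mul_of_nonneg_right (show 1 / 2 ≤ 3 / 4 - mu b' k₁ k₀ ^ 2 by linarith)
          (sq_nonneg ‖gs b k₀‖)
        linarith

/-- Induction on the potential and, for equal potential, on the distance of the index from `d`. -/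
theorem LLLInv.exists_halt {L : Submodule ℤ (Fin N → ℤ)} (s : (Fin d → Fin N → ℤ) × ℕ)
    (hs : LLLInv L s) : ∃ t : ℕ, d ≤ (lllStep^[t] s).2 ∧ LLLInv L (lllStep^[t] s) := by
  induction hp : potential s.1 using Nat.strong_induction_on generalizing s with
  | _ p ihp =>
    induction hm : d - s.2 generalizing s with
    | zero => exact ⟨0, Nat.sub_eq_zero_iff_le.1 hm, hs⟩
    | succ m ihm =>
      obtain ⟨hs', h⟩ := hs.step (by omega)
      have : ∃ t : ℕ, d ≤ (lllStep^[t] (lllStep s)).2 ∧ LLLInv L (lllStep^[t] (lllStep s)) := by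
        rcases h with h | ⟨h, h2⟩
        · exact ihp _ (hp ▸ h) _ hs' rfl
        · exact ihm _ hs' (h.trans hp) (by omega)
      obtain ⟨t, ht⟩ := this
      exact ⟨t + 1, by rwa [Function.iterate_succ_apply]⟩

theorem norm_gs_zero_le {b : Fin (d + 1) → Fin N → ℤ}
    (hdec : ∀ i j : Fin (d + 1), (i : ℕ) + 1 = j → ‖gs b i‖ ^ 2 ≤ 2 * ‖gs b j‖ ^ 2)
    (i : Fin (d + 1)) : ‖gs b 0‖ ^ 2 ≤ 2 ^ (i : ℕ) * ‖gs b i‖ ^ 2 := by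
  induction i using Fin.induction with
  | zero => simp
  | succ i ih =>
    have := hdec i.castSucc i.succ (by simp)
    rw [Fin.val_succ, pow_succ]
    rw [Fin.val_castSucc] at ih
    calc _ ≤ _ := ih
      _ ≤ 2 ^ (i : ℕ) * (2 * ‖gs b i.succ‖ ^ 2) := by gcongr
      _ = _ := by ring

/-- The length of a nonzero lattice vector is at least that of some Gram-Schmidt vector, namely
the one belonging to the last basis vector that occurs in it. -/
theorem exists_norm_gs_le {b : Fin d → Fin N → ℤ} {x : Fin N → ℤ}
    (hx : x ∈ Submodule.span ℤ (Set.range b)) (hx0 : x ≠ 0) :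
    ∃ i, ‖gs b i‖ ^ 2 ≤ ‖toEuclid x‖ ^ 2 := by
  obtain ⟨c, rfl⟩ := (Submodule.mem_span_range_iff_exists_fun ℤ).1 hx
  have hne : (Finset.univ.filter fun i => c i ≠ 0).Nonempty := by
    by_contra h
    rw [Finset.not_nonempty_iff_eq_empty] at h
    refine hx0 (Finset.sum_eq_zero fun i _ => ?_)
    have : c i = 0 := by
      by_contra hi
      exact Finset.notMem_empty i (h ▸ Finset.mem_filter.2 ⟨Finset.mem_univ i, hi⟩)
    rw [this, zero_smul]
  obtain ⟨i, hi, hmax⟩ := Finset.exists_max_image _ id hne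
  have hci : c i ≠ 0 := (Finset.mem_filter.1 hi).2
  refine ⟨i, ?_⟩
  have hsum : toEuclid (∑ j, c j • b j) = ∑ j, (c j : ℝ) • toEuclid (b j) := by
    ext l
    simp [toEuclid]
  have hinner : inner ℝ (gs b i) (toEuclid (∑ j, c j • b j)) = c i * ‖gs b i‖ ^ 2 := by
    rw [hsum, inner_sum, Finset.sum_eq_single i, inner_smul_right]
    · rw [gs, inner_gramSchmidt_self (fun i => toEuclid (b i)) i]
    · intro j _ hj
      rw [inner_smul_right]
      rcases lt_or_gt_of_ne hj with h | h
      · rw [gs, gramSchmidt_inv_triangular ℝ (fun i => toEuclid (b i)) h, mul_zero]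
      · have : c j = 0 := by
          by_contra hcj
          exact absurd (hmax j (Finset.mem_filter.2 ⟨Finset.mem_univ j, hcj⟩)) (not_le.2 h)
        rw [this, Int.cast_zero, zero_mul]
    · simp
  have hcs := abs_real_inner_le_norm (gs b i) (toEuclid (∑ j, c j • b j))
  have hc1 : (1 : ℝ) ≤ |(c i : ℝ)| := by exact_mod_cast Int.one_le_abs hci
  rw [hinner, abs_mul, abs_of_nonneg (sq_nonneg ‖gs b i‖)] at hcs
  rcases (norm_nonneg (gs b i)).eq_or_lt with h0 | h0
  · rw [← h0, zero_pow two_ne_zero]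
    positivity
  · refine pow_le_pow_left₀ h0.le (le_of_mul_le_mul_left ?_ h0) 2
    refine le_trans ?_ hcs
    nlinarith [sq_nonneg ‖gs b i‖]

/-- LLL, run on linearly independent vectors, halts, and the first vector that it returns is a
nonzero vector of the lattice, at most `2 ^ (d / 2)` times as long as any other one. -/
theorem exists_lllReturns (M : Matrix (Fin N) (Fin (d + 1)) ℤ)
    (hM : LinearIndependent ℝ fun j => toEuclid (M.transpose j)) :
    ∃ x, LLLReturns M x ∧ x ∈ Submodule.span ℤ (Set.range M.transpose) ∧ x ≠ 0 ∧
      ∀ y ∈ Submodule.span ℤ (Set.range M.transpose), y ≠ 0 →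
        ∑ i, x i ^ 2 ≤ 2 ^ d * ∑ i, y i ^ 2 := by
  have h0 : LLLInv (Submodule.span ℤ (Set.range M.transpose))
      ((M.transpose, 1) : (Fin (d + 1) → Fin N → ℤ) × ℕ) :=
    ⟨rfl, fun i => gramSchmidt_ne_zero i hM, fun i j hij hj => by dsimp only at hj; omega, le_rfl⟩
  obtain ⟨t, ht, hspan, hne, hdec, -⟩ := h0.exists_halt
  set b := (lllStep^[t] ((M.transpose, 1) : (Fin (d + 1) → Fin N → ℤ) × ℕ)).1 with hb
  have hg0 : gs b 0 = toEuclid (b 0) := gramSchmidt_bot ℝ (fun i => toEuclid (b i))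
  refine ⟨b 0, ⟨t, ht, rfl⟩, ?_, ?_, fun y hy hy0 => ?_⟩
  · rw [← hspan]
    exact Submodule.subset_span ⟨0, rfl⟩
  · intro hz
    apply hne 0
    rw [hg0, hz]
    ext i
    simp [toEuclid]
  · rw [← hspan] at hy
    obtain ⟨i, hi⟩ := exists_norm_gs_le hy hy0
    have h1 := norm_gs_zero_le (fun i j hij => hdec i j hij (j.isLt.trans_le ht)) i
    have h2 : (2 : ℝ) ^ (i : ℕ) ≤ 2 ^ d := pow_le_pow_right₀ one_le_two (by omega)
    have h3 : ‖toEuclid (b 0)‖ ^ 2 ≤ 2 ^ d * ‖toEuclid y‖ ^ 2 := by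
      rw [← hg0]
      exact h1.trans (mul_le_mul h2 hi (sq_nonneg _) (by positivity))
    rw [norm_toEuclid_sq, norm_toEuclid_sq] at h3
    exact_mod_cast h3

end LLL

/-! ### The lattice of a subset sum instance -/

section Lattice

variable {n : ℕ}

theorem latticeMatrix_mulVec (B₀ : ℤ) (w : Fin n → ℤ) (c : Fin (n + 1) → ℤ) :
    (latticeMatrix B₀ w).mulVec c =
      (Fin.cons (B₀ * c 0 - ∑ i, w i * c i.succ) c : Fin (n + 2) → ℤ) := by
  funext i
  refine Fin.cases ?_ (fun i => ?_) i
  · simp [Matrix.mulVec, dotProduct, latticeMatrix, Fin.sum_univ_succ, sub_eq_add_neg]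
  · simp [Matrix.mulVec, dotProduct, latticeMatrix]

theorem linearIndependent_latticeMatrix (B₀ : ℤ) (w : Fin n → ℤ) :
    LinearIndependent ℝ fun j => toEuclid ((latticeMatrix B₀ w).transpose j) := by
  rw [Fintype.linearIndependent_iff]
  intro g hg i
  have := congrArg (fun v : EuclideanSpace ℝ (Fin (n + 2)) => v i.succ) hg
  simpa [toEuclid, latticeMatrix] using this

theorem mem_span_transpose_iff {N d : ℕ} (M : Matrix (Fin N) (Fin d) ℤ) (x : Fin N → ℤ) :
    x ∈ Submodule.span ℤ (Set.range M.transpose) ↔ ∃ c, M.mulVec c = x := by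
  refine (Submodule.mem_span_range_iff_exists_fun ℤ).trans (exists_congr fun c => ?_)
  rw [Matrix.mulVec_eq_sum]
  simp

theorem fVec_eq (B e ν : Fin n → ℤ) :
    fVec B e ν = (Fin.cons (-∑ i, ν i * e i) (Fin.cons 1 e) : Fin (n + 2) → ℤ) := by
  rw [fVec, noisyMatrix, latticeMatrix_mulVec]
  congr 1
  simp [target, add_mul, Finset.sum_add_distrib]

theorem abs_sum_noise_mul_le {ν : Fin n → ℤ} (hν : IsNoise ν) (a : Fin n → ℤ) {K : ℤ}
    (ha : ∀ i, |a i| ≤ K) : |∑ i, ν i * a i| ≤ n * K := by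
  calc |∑ i, ν i * a i| ≤ ∑ i, |ν i * a i| := Finset.abs_sum_le_sum_abs _ _
    _ ≤ ∑ _i : Fin n, K := Finset.sum_le_sum fun i _ => by
        rcases hν i with h | h | h
        · simpa [h] using ha i
        · simpa [h] using (abs_nonneg _).trans (ha i)
        · simpa [h] using ha i
    _ = n * K := by simp

theorem abs_le_one_of_zero_or_one {e : Fin n → ℤ} (he : ∀ i, e i = 0 ∨ e i = 1) (i : Fin n) :
    |e i| ≤ 1 := by
  rcases he i with h | h <;> simp [h]

theorem sum_fVec_sq_le (B : Fin n → ℤ) {e ν : Fin n → ℤ} (he : ∀ i, e i = 0 ∨ e i = 1)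
    (hν : IsNoise ν) : ∑ i, fVec B e ν i ^ 2 ≤ (n : ℤ) ^ 2 + n + 1 := by
  rw [fVec_eq, Fin.sum_univ_succ, Fin.sum_univ_succ]
  simp only [Fin.cons_zero, Fin.cons_succ]
  have h1 : (-∑ i, ν i * e i) ^ 2 ≤ (n : ℤ) ^ 2 := by
    have := abs_sum_noise_mul_le hν e (abs_le_one_of_zero_or_one he)
    rw [mul_one] at this
    rw [neg_sq]
    exact sq_le_sq' (abs_le.1 this).1 (abs_le.1 this).2
  have h2 : ∑ i, e i ^ 2 ≤ (n : ℤ) := by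
    calc ∑ i, e i ^ 2 ≤ ∑ _i : Fin n, (1 : ℤ) := Finset.sum_le_sum fun i _ => by
          rcases he i with h | h <;> simp [h]
      _ = n := by simp
  linarith

/-- A bound for the entries of the vector returned by LLL, when the lattice contains a vector of
squared length at most `n² + n + 1`. -/
def entryBound (n : ℕ) : ℕ := Nat.sqrt (2 ^ n * (n ^ 2 + n + 1))

/-- If no nontrivial integer relation `∑ Bᵢ zᵢ = m` holds with `z = c₀ e - (c₁, …, c_n)` and small
`c` and `m`, then every short lattice vector is a multiple of `f`. -/
theorem solved_of_forall_sum_ne {B e ν : Fin n → ℤ} (he : ∀ i, e i = 0 ∨ e i = 1)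
    (hν : IsNoise ν)
    (h : ∀ c : Fin (n + 1) → ℤ, (∀ i, |c i| ≤ entryBound n) → ∀ m : ℤ,
      |m| ≤ (n + 1) * entryBound n → (∃ i, c 0 * e i - c i.succ ≠ 0) →
        ∑ i, B i * (c 0 * e i - c i.succ) ≠ m) : Solved B e ν := by
  obtain ⟨x, hx, hmem, hx0, hmin⟩ := exists_lllReturns (noisyMatrix B e ν)
    (linearIndependent_latticeMatrix _ _)
  have hf : fVec B e ν ∈ Submodule.span ℤ (Set.range (noisyMatrix B e ν).transpose) :=
    (mem_span_transpose_iff _ _).2 ⟨_, rfl⟩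
  have hf0 : fVec B e ν ≠ 0 := fun h0 => by
    have := congrFun h0 1
    rw [fVec_eq, ← Fin.succ_zero_eq_one] at this
    simp at this
  have hshort : ∀ i, |x i| ≤ (entryBound n : ℤ) := by
    intro i
    have h1 : x i ^ 2 ≤ 2 ^ n * ((n : ℤ) ^ 2 + n + 1) :=
      calc x i ^ 2 ≤ ∑ i, x i ^ 2 :=
            Finset.single_le_sum (f := fun i => x i ^ 2) (fun i _ => sq_nonneg _)
              (Finset.mem_univ i)
        _ ≤ 2 ^ n * ∑ i, fVec B e ν i ^ 2 := hmin _ hf hf0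
        _ ≤ _ := by gcongr; exact sum_fVec_sq_le B he hν
    have h2 : (x i).natAbs ≤ entryBound n := by
      rw [entryBound, Nat.le_sqrt']
      rw [← Int.natAbs_sq] at h1
      exact_mod_cast h1
    rw [Int.abs_eq_natAbs]
    exact_mod_cast h2
  obtain ⟨c, hc⟩ := (mem_span_transpose_iff _ _).1 hmem
  rw [noisyMatrix, latticeMatrix_mulVec] at hc
  have hcx : ∀ i, c i = x i.succ := fun i => by rw [← hc, Fin.cons_succ]
  have hcb : ∀ i, |c i| ≤ (entryBound n : ℤ) := fun i => hcx i ▸ hshort _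
  have hz : ∀ i : Fin n, c i.succ = c 0 * e i := by
    by_contra hcon
    push Not at hcon
    obtain ⟨i, hi⟩ := hcon
    -- the noise only shifts the right-hand side of the relation
    refine h c hcb (x 0 + ∑ i, ν i * c i.succ) ?_ ⟨i, sub_ne_zero.2 (Ne.symm hi)⟩ ?_
    · have h1 := abs_sum_noise_mul_le hν (fun i => c i.succ) fun i => hcb i.succ
      have h2 := abs_add_le (x 0) (∑ i, ν i * c i.succ)
      have h3 := hshort 0
      linarith
    · rw [← hc, Fin.cons_zero]
      simp only [target, Pi.add_apply, mul_sub, add_mul, Finset.sum_sub_distrib,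
        Finset.sum_add_distrib, Finset.sum_mul]
      rw [sub_add_eq_sub_sub, sub_add_cancel]
      congr 1
      exact Finset.sum_congr rfl fun i _ => by ring
  have hxf : x = c 0 • fVec B e ν := by
    rw [← hc, fVec_eq]
    funext i
    refine Fin.cases ?_ (fun i => Fin.cases ?_ (fun i => ?_) i) i
    · simp only [hz, target, Pi.add_apply, Fin.cons_zero, Pi.smul_apply, smul_eq_mul, add_mul,
        Finset.sum_add_distrib, Finset.sum_mul, mul_neg, Finset.mul_sum]
      rw [sub_add_eq_sub_sub, sub_eq_add_neg]
      rw [show ∑ i, B i * e i * c 0 - ∑ i, B i * (c 0 * e i) = 0 from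
        sub_eq_zero.2 (Finset.sum_congr rfl fun i _ => by ring), zero_add]
      exact congrArg _ (Finset.sum_congr rfl fun i _ => by ring)
    · simp
    · simp [hz]
  have hc0 : c 0 ≠ 0 := fun h0 => hx0 (by rw [hxf, h0, zero_smul])
  refine ⟨x, hx, ⟨c 0, hc0, hxf⟩, ?_⟩
  funext i
  rw [decode, ← Fin.succ_zero_eq_one, ← hcx, ← hcx, hz, Int.mul_ediv_cancel_left _ hc0]

end Lattice

/-! ### The probability of a small integer relation -/

section Probability

open scoped ENNReal

/-- A nontrivial linear relation determines the coordinate `B j`, where `z j ≠ 0`, from the other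
coordinates; the bound follows by integrating over these. -/
theorem pi_setOf_sum_mul_eq_le {n : ℕ} (μ : Measure ℤ) [IsProbabilityMeasure μ] {δ : ℝ≥0∞}
    (hδ : ∀ a, μ {a} ≤ δ) (z : Fin n → ℤ) (hz : ∃ i, z i ≠ 0) (m : ℤ) :
    Measure.pi (fun _ : Fin n => μ) {B | ∑ i, B i * z i = m} ≤ δ := by
  obtain ⟨j, hj⟩ := hz
  obtain _ | n := n
  · exact j.elim0
  have hmp := measurePreserving_piFinSuccAbove (fun _ : Fin (n + 1) => μ) j
  have hpre : {B : Fin (n + 1) → ℤ | ∑ i, B i * z i = m} =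
      MeasurableEquiv.piFinSuccAbove (fun _ => ℤ) j ⁻¹'
        {p | p.1 * z j + ∑ i, p.2 i * z (j.succAbove i) = m} := by
    ext B
    simp [Fin.sum_univ_succAbove _ j, Fin.removeNth]
  rw [hpre, hmp.measure_preimage_equiv, Measure.prod_apply_symm (Set.to_countable _).measurableSet]
  calc _ ≤ ∫⁻ _, δ ∂(Measure.pi fun _ : Fin n => μ) := by
        refine lintegral_mono fun q => ?_
        have hsub : ((fun p : ℤ => (p, q)) ⁻¹'
            {p | p.1 * z j + ∑ i, p.2 i * z (j.succAbove i) = m}).Subsingleton := by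
          intro a ha b hb
          simp only [Set.mem_preimage, Set.mem_ofPred_eq] at ha hb
          exact mul_right_cancel₀ hj (by linarith)
        rcases hsub.eq_empty_or_singleton with h | ⟨a, h⟩
        · rw [h]; simp
        · rw [h]; exact hδ a
    _ = δ := by simp

theorem one_le_maxWeight {ε : ℝ} (hε : 0 < ε) (n : ℕ) : 1 ≤ maxWeight ε n := by
  rw [maxWeight, Int.le_floor, Int.cast_one]
  exact Real.one_le_rpow one_le_two (by positivity)

theorem uniformOn_Icc_singleton_le {M : ℤ} (hM : 1 ≤ M) (a : ℤ) :
    uniformOn (Set.Icc 1 M) {a} ≤ ENNReal.ofReal (1 / M) := by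
  have hcard : Measure.count (Set.Icc 1 M) = ENNReal.ofReal M := by
    rw [← Finset.coe_Icc, Measure.count_apply_finset, Int.card_Icc,
      ← ENNReal.ofReal_natCast]
    congr 1
    have : (((M + 1 - 1).toNat : ℤ) : ℝ) = M := by
      rw [Int.toNat_of_nonneg (by omega)]
      simp
    exact_mod_cast this
  have hM' : (0 : ℝ) < M := by exact_mod_cast hM
  rw [uniformOn, cond_apply (Set.finite_Icc 1 M).measurableSet, hcard, one_div,
    ENNReal.ofReal_inv_of_pos hM']
  refine mul_le_of_le_one_right' ?_
  exact (measure_mono Set.inter_subset_right).trans (Measure.count_singleton a).le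

/-- The union bound over all candidate relations. -/
theorem weightLaw_not_solved_le {ε : ℝ} (hε : 0 < ε) {n : ℕ} {e : Fin n → ℤ}
    (he : ∀ i, e i = 0 ∨ e i = 1) :
    weightLaw ε n {B | ∃ ν, IsNoise ν ∧ ¬ Solved B e ν} ≤
      ENNReal.ofReal ((2 * entryBound n + 1) ^ (n + 1) * (2 * ((n + 1) * entryBound n) + 1) *
        (1 / maxWeight ε n)) := by
  set K := entryBound n with hK
  let T : Finset ((Fin (n + 1) → ℤ) × ℤ) :=
    (Fintype.piFinset fun _ => Finset.Icc (-(K : ℤ)) K) ×ˢ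
      Finset.Icc (-((n + 1) * K : ℤ)) ((n + 1) * K)
  have hT : (T.card : ℝ) = (2 * K + 1) ^ (n + 1) * (2 * ((n + 1) * K) + 1) := by
    have h1 : ∀ a : ℕ, ((a : ℤ) + 1 - -a).toNat = 2 * a + 1 := fun a => by omega
    have h2 : ((n + 1) * K : ℤ) = ((n + 1) * K : ℕ) := by push_cast; ring
    simp only [T, Finset.card_product, Fintype.card_piFinset_const, Int.card_Icc]
    rw [h2, h1, h1]
    push_cast
    ring
  let U := T.filter fun p => ∃ i : Fin n, p.1 0 * e i - p.1 i.succ ≠ 0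
  have hsub : {B | ∃ ν, IsNoise ν ∧ ¬ Solved B e ν} ⊆
      ⋃ p ∈ U, {B : Fin n → ℤ | ∑ i, B i * (p.1 0 * e i - p.1 i.succ) = p.2} := by
    rintro B ⟨ν, hν, hB⟩
    by_contra hcon
    refine hB (solved_of_forall_sum_ne he hν fun c hc m hm hz hsum => hcon ?_)
    refine Set.mem_iUnion₂.2 ⟨(c, m), Finset.mem_filter.2 ⟨Finset.mem_product.2 ⟨?_, ?_⟩, hz⟩, hsum⟩
    · exact Fintype.mem_piFinset.2 fun i => Finset.mem_Icc.2 (abs_le.1 (hc i))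
    · exact Finset.mem_Icc.2 (abs_le.1 hm)
  have hM := one_le_maxWeight hε n
  have : IsProbabilityMeasure (uniformOn (Set.Icc 1 (maxWeight ε n))) :=
    isProbabilityMeasure_uniformOn (Set.finite_Icc _ _) ⟨1, le_rfl, hM⟩
  calc weightLaw ε n {B | ∃ ν, IsNoise ν ∧ ¬ Solved B e ν}
      ≤ ∑ p ∈ U, weightLaw ε n {B | ∑ i, B i * (p.1 0 * e i - p.1 i.succ) = p.2} :=
        (measure_mono hsub).trans (measure_biUnion_finset_le _ _)
    _ ≤ ∑ _p ∈ U, ENNReal.ofReal (1 / maxWeight ε n) := Finset.sum_le_sum fun p hp =>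
        pi_setOf_sum_mul_eq_le _ (uniformOn_Icc_singleton_le hM) _ (Finset.mem_filter.1 hp).2 _
    _ ≤ ∑ _p ∈ T, ENNReal.ofReal (1 / maxWeight ε n) :=
        Finset.sum_le_sum_of_subset (Finset.filter_subset _ _)
    _ = _ := by
        rw [Finset.sum_const, nsmul_eq_mul, ← hT, ENNReal.ofReal_mul (Nat.cast_nonneg _),
          ENNReal.ofReal_natCast]

end Probability

/-! ### Asymptotics of the union bound -/

section Asymptotics

open Filter

theorem entryBound_le (n : ℕ) : (entryBound n : ℝ) ≤ (2 : ℝ) ^ ((n : ℝ) / 2) * (n + 1) := by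
  refine le_of_sq_le_sq ?_ (by positivity)
  have h1 : entryBound n ^ 2 ≤ 2 ^ n * (n ^ 2 + n + 1) := Nat.sqrt_le' _
  have h2 : (entryBound n : ℝ) ^ 2 ≤ 2 ^ n * ((n : ℝ) ^ 2 + n + 1) := by exact_mod_cast h1
  have h3 : ((2 : ℝ) ^ ((n : ℝ) / 2)) ^ 2 = 2 ^ n := by
    rw [← Real.rpow_natCast, ← Real.rpow_mul zero_le_two, ← Real.rpow_natCast]
    congr 1
    push_cast
    ring
  rw [mul_pow, h3]
  refine h2.trans (mul_le_mul_of_nonneg_left ?_ (by positivity))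
  nlinarith [(Nat.cast_nonneg n : (0 : ℝ) ≤ n)]

theorem eventually_pow_le {ε : ℝ} (hε : 0 < ε) :
    ∀ᶠ n : ℕ in atTop, ((n : ℝ) + 1) ^ (3 * n + 6) ≤ (2 : ℝ) ^ (ε * (n : ℝ) ^ 2 / 2) := by
  have hl2 : 0 < Real.log 2 := Real.log_pos one_lt_two
  have hδ : 0 < ε * Real.log 2 / 36 := by positivity
  have ht : Tendsto (fun n : ℕ => (n : ℝ) + 1) atTop atTop :=
    tendsto_atTop_add_const_right _ _ tendsto_natCast_atTop_atTop
  have hlog := (Real.isLittleO_log_id_atTop.comp_tendsto ht).bound hδ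
  filter_upwards [hlog, eventually_ge_atTop 1] with n hn h1
  have h1' : (1 : ℝ) ≤ n := by exact_mod_cast h1
  have hpos : (0 : ℝ) < n + 1 := by positivity
  simp only [Function.comp_apply, id, Real.norm_eq_abs, abs_of_pos hpos] at hn
  have hn' := (le_abs_self _).trans hn
  rw [← Real.log_le_log_iff (by positivity) (by positivity), Real.log_pow,
    Real.log_rpow zero_lt_two]
  push_cast
  calc (3 * (n : ℝ) + 6) * Real.log (n + 1)
      ≤ (9 * n) * (ε * Real.log 2 / 36 * (2 * n)) := by
        -- `3 n + 6 ≤ 9 n` and `n + 1 ≤ 2 n`, whence the constant `36`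
        refine mul_le_mul (by linarith) (hn'.trans ?_) (Real.log_nonneg (by linarith))
          (by positivity)
        exact mul_le_mul_of_nonneg_left (by linarith) hδ.le
    _ = _ := by ring

theorem eventually_unionBound_le {ε : ℝ} (hε : 0 < ε) :
    ∀ᶠ n : ℕ in atTop,
      ((2 * (entryBound n : ℝ) + 1) ^ (n + 1) * (2 * ((n + 1) * entryBound n) + 1) *
        (1 / maxWeight ε n)) ≤ (2 : ℝ) ^ (-(ε * (n : ℝ) ^ 2 / 2)) := by
  filter_upwards [eventually_pow_le hε, eventually_ge_atTop 2] with n hn h2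
  have h2' : (2 : ℝ) ≤ n := by exact_mod_cast h2
  set R : ℝ := (2 : ℝ) ^ ((n : ℝ) / 2) * (n + 1) with hR
  have hK : (entryBound n : ℝ) ≤ R := entryBound_le n
  have hR1 : 1 ≤ R := by
    have := Real.one_le_rpow one_le_two (show (0 : ℝ) ≤ n / 2 by positivity)
    nlinarith
  have hM : 1 / (maxWeight ε n : ℝ) ≤ 2 * (2 : ℝ) ^ (-((1 / 2 + ε) * (n : ℝ) ^ 2)) := by
    have h1 : (1 : ℝ) ≤ maxWeight ε n := by exact_mod_cast one_le_maxWeight hε n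
    have h3 : (2 : ℝ) ^ ((1 / 2 + ε) * (n : ℝ) ^ 2) < maxWeight ε n + 1 := Int.lt_floor_add_one _
    rw [Real.rpow_neg zero_le_two, ← div_eq_mul_inv,
      div_le_div_iff₀ (by linarith) (by positivity)]
    linarith
  have hA : (2 * (entryBound n : ℝ) + 1) ^ (n + 1) ≤ (3 * R) ^ (n + 1) := by
    gcongr
    linarith
  have hB : 2 * (((n : ℝ) + 1) * entryBound n) + 1 ≤ 3 * R * (n + 1) := by nlinarith
  have hRpow : R ^ (n + 2) = (2 : ℝ) ^ ((n : ℝ) ^ 2 / 2) * 2 ^ n * (n + 1) ^ (n + 2) := by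
    rw [hR, mul_pow, ← Real.rpow_natCast ((2 : ℝ) ^ ((n : ℝ) / 2)), ← Real.rpow_mul zero_le_two,
      ← Real.rpow_natCast 2 n, ← Real.rpow_add zero_lt_two]
    congr 2
    push_cast
    ring
  have h2p : (2 : ℝ) ^ (n + 1) ≤ (n + 1) ^ (n + 1) := by gcongr; linarith
  have h3p : (3 : ℝ) ^ (n + 2) ≤ (n + 1) ^ (n + 2) := by gcongr; linarith
  calc _ ≤ (3 * R) ^ (n + 1) * (3 * R * (n + 1)) *
        (2 * (2 : ℝ) ^ (-((1 / 2 + ε) * (n : ℝ) ^ 2))) := by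
        refine mul_le_mul (mul_le_mul hA hB (by positivity) (by positivity)) hM ?_ (by positivity)
        have := one_le_maxWeight hε n
        have : (0 : ℝ) ≤ maxWeight ε n := by exact_mod_cast zero_le_one.trans this
        positivity
    _ = 3 ^ (n + 2) * 2 ^ (n + 1) * ((n : ℝ) + 1) ^ (n + 3) *
        ((2 : ℝ) ^ ((n : ℝ) ^ 2 / 2) * (2 : ℝ) ^ (-((1 / 2 + ε) * (n : ℝ) ^ 2))) := by
        have : (3 * R) ^ (n + 1) * (3 * R * (n + 1)) = 3 ^ (n + 2) * R ^ (n + 2) * (n + 1) := by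
          rw [mul_pow]
          ring
        rw [this, hRpow]
        ring
    _ ≤ (n + 1) ^ (n + 2) * (n + 1) ^ (n + 1) * ((n : ℝ) + 1) ^ (n + 3) *
        ((2 : ℝ) ^ ((n : ℝ) ^ 2 / 2) * (2 : ℝ) ^ (-((1 / 2 + ε) * (n : ℝ) ^ 2))) := by gcongr
    _ = ((n : ℝ) + 1) ^ (3 * n + 6) * (2 : ℝ) ^ (-(ε * (n : ℝ) ^ 2)) := by
        rw [← Real.rpow_add zero_lt_two, ← pow_add, ← pow_add]
        congr 1
        · congr 1
          ring
        · congr 1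
          ring
    _ ≤ (2 : ℝ) ^ (ε * (n : ℝ) ^ 2 / 2) * (2 : ℝ) ^ (-(ε * (n : ℝ) ^ 2)) := by gcongr
    _ = _ := by
        rw [← Real.rpow_add zero_lt_two]
        congr 1
        ring

end Asymptotics

end NoisySubsetSum

end

theorem mainTheorem3 :
    (∀ (n : ℕ) (B e ν : Fin n → ℤ), (∀ i, e i = 0 ∨ e i = 1) → NoisySubsetSum.IsNoise ν →
      ∃ f₀ : ℤ, |f₀| ≤ (n : ℤ) ∧
        NoisySubsetSum.fVec B e ν = (Fin.cons f₀ (Fin.cons 1 e) : Fin (n + 2) → ℤ)) ∧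
    ∀ ε : ℝ, 0 < ε → ∃ n₀ : ℕ, ∀ n : ℕ, n₀ < n →
      ∀ e : Fin n → ℤ, (∀ i, e i = 0 ∨ e i = 1) →
        NoisySubsetSum.weightLaw ε n
            {B | ∃ ν : Fin n → ℤ, NoisySubsetSum.IsNoise ν ∧ ¬ NoisySubsetSum.Solved B e ν}
          ≤ ENNReal.ofReal ((2 : ℝ) ^ (-(ε * (n : ℝ) ^ 2 / 2))) := by
  refine ⟨fun n B e ν he hν => ⟨_, ?_, NoisySubsetSum.fVec_eq B e ν⟩, fun ε hε => ?_⟩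
  · rw [abs_neg]
    simpa using NoisySubsetSum.abs_sum_noise_mul_le hν e
      (NoisySubsetSum.abs_le_one_of_zero_or_one he)
  · obtain ⟨n₀, hn₀⟩ := Filter.eventually_atTop.1 (NoisySubsetSum.eventually_unionBound_le hε)
    exact ⟨n₀, fun n hn e he => (NoisySubsetSum.weightLaw_not_solved_le hε he).trans
      (ENNReal.ofReal_le_ofReal (hn₀ n hn.le))⟩
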